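/- Let $k$ be a field and let $\nu\colon \Gamma\to\Lambda$ be an injective (unital) homomorphism of finite-dimensional associative $k$-algebras, by which we view $\Gamma$ as a subalgebra of $\Lambda$. Write $\operatorname{rad}$ for the Jacobson radical, put $\mathfrak r=\operatorname{rad}\Gamma$, and let $\Lambda\mathfrak r$ denote the left ideal of $\Lambda$ generated by $\nu(\mathfrak r)$. Assume that $\Lambda\mathfrak r=\operatorname{rad}\Lambda$ and that $\Lambda$, regarded as a right $\Gamma$-module via $\nu$, is projective. For a ring $R$ and a left $R$-module $M$, regard $\operatorname{Ext}_R^*(M,M)=\bigoplus_{n\ge 0}\operatorname{Ext}_R^n(M,M)$ as a ring under the Yoneda product, where $\theta\cdot\eta$ is the composition of first $\eta$ and then $\theta$. If the ring $\operatorname{Ext}^*_\Gamma(\Gamma/\mathfrak r,\Gamma/\mathfrak r)$ is right Noetherian, then the ring $\operatorname{Ext}^*_\Lambda(\Lambda/\operatorname{rad}\Lambda,\Lambda/\operatorname{rad}\Lambda)$ is right Noetherian. -/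

import Mathlib

open CategoryTheory

universe w v u

/-- The degree `n` part `Extⁿ(X, X)` of the self-extension algebra of an object `X`. -/
def SelfExt {C : Type u} [Category.{v} C] [Abelian C] [HasExt.{w} C] (X : C) (n : ℕ) : Type w :=
  Abelian.Ext.{w} X X n

namespace SelfExt

variable {C : Type u} [Category.{v} C] [Abelian C] [HasExt.{w} C] (X : C)

noncomputable instance (n : ℕ) : AddCommGroup (SelfExt.{w} X n) :=
  inferInstanceAs (AddCommGroup (Abelian.Ext.{w} X X n))

variable {X}

/-- The Yoneda product `θ · η`, in the order of composition of maps: first `η`, then `θ`.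
(Mathlib's `Abelian.Ext.comp` is written in diagrammatic order.) -/
noncomputable def yonedaMul {m n : ℕ} (θ : SelfExt.{w} X m) (η : SelfExt.{w} X n) :
    SelfExt.{w} X (m + n) :=
  Abelian.Ext.comp (X := X) (Y := X) (Z := X) η θ (Nat.add_comm n m)

variable (X) in
/-- The identity of `X`, as an element of `Ext⁰(X, X)`. -/
noncomputable def unit : SelfExt.{w} X 0 := Abelian.Ext.mk₀ (𝟙 X)

lemma mk_eq_mk {m n : ℕ} (h : m = n) (a : SelfExt.{w} X m) (b : SelfExt.{w} X n)
    (hab : ∀ h' : m = n, h' ▸ a = b) : GradedMonoid.mk m a = GradedMonoid.mk n b := by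
  subst h
  exact congrArg _ (hab rfl)

lemma cast_comp {m n p q : ℕ} (h : p = q) (η : Abelian.Ext.{w} X X n)
    (θ : Abelian.Ext.{w} X X m) (hp : n + m = p) :
    (h ▸ (η.comp θ hp : SelfExt.{w} X p) : SelfExt.{w} X q) = η.comp θ (hp.trans h) := by
  subst h; rfl

noncomputable instance : GradedMonoid.GMul (SelfExt.{w} X) := ⟨yonedaMul⟩

noncomputable instance : GradedMonoid.GOne (SelfExt.{w} X) := ⟨unit X⟩

noncomputable instance : GradedMonoid.GMonoid (SelfExt.{w} X) where
  one_mul := by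
    rintro ⟨n, a⟩
    refine mk_eq_mk (Nat.zero_add n) _ _ fun h => ?_
    exact (cast_comp (X := X) h a (Abelian.Ext.mk₀ (𝟙 X)) (Nat.add_comm n 0)).trans
      (Abelian.Ext.comp_mk₀_id (X := X) (Y := X) a)
  mul_one := by
    rintro ⟨n, a⟩
    refine mk_eq_mk (Nat.add_zero n) _ _ fun h => ?_
    exact (cast_comp (X := X) h (Abelian.Ext.mk₀ (𝟙 X)) a (Nat.add_comm 0 n)).trans
      (Abelian.Ext.mk₀_id_comp (X := X) (Y := X) a)
  mul_assoc := by
    rintro ⟨l, a⟩ ⟨m, b⟩ ⟨n, c⟩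
    refine mk_eq_mk (Nat.add_assoc l m n) _ _ fun h => ?_
    exact (cast_comp (X := X) h c (yonedaMul a b) (Nat.add_comm n (l + m))).trans
      (Abelian.Ext.comp_assoc (X := X) (Y := X) (Z := X) (T := X) c b a
        (Nat.add_comm n m) (Nat.add_comm m l) (by omega)).symm

noncomputable instance : DirectSum.GRing (SelfExt.{w} X) where
  mul_zero {i j} a := Abelian.Ext.zero_comp X (n := j) (Y := X) (Z := X) a (i + j) (Nat.add_comm j i)
  zero_mul {i j} b := Abelian.Ext.comp_zero (X := X) (Y := X) b X i (i + j) (Nat.add_comm j i)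
  mul_add {i j} a b c := Abelian.Ext.add_comp (X := X) (Y := X) (Z := X) b c a (Nat.add_comm j i)
  add_mul {i j} a b c := Abelian.Ext.comp_add (X := X) (Y := X) (Z := X) c a b (Nat.add_comm j i)
  natCast n := n • unit X
  natCast_zero := zero_smul ℕ _
  natCast_succ n := succ_nsmul _ n
  intCast n := n • unit X
  intCast_ofNat n := natCast_zsmul _ n
  intCast_negSucc_ofNat n := negSucc_zsmul _ n

end SelfExt

/-- The Ext-algebra `Ext^*(X, X) = ⨁ₙ Extⁿ(X, X)`, a ring under the Yoneda product. -/
abbrev ExtAlgebra {C : Type u} [Category.{v} C] [Abelian C] [HasExt.{w} C] (X : C) : Type w :=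
  DirectSum ℕ (SelfExt.{w} X)

/-- A ring is right Noetherian if its right ideals, i.e. the left ideals of the opposite ring,
satisfy the ascending chain condition. -/
abbrev IsRightNoetherianRing (R : Type u) [Ring R] : Prop := IsNoetherianRing Rᵐᵒᵖ

/-- For a ring homomorphism `ν : Γ → Λ`, the right `Γ`-module `Λ_Γ` (with `x · γ = x * ν γ`)
is projective. Right `Γ`-modules are modules over `Γᵐᵒᵖ`. -/
def IsRightProjectiveOver {Γ : Type v} {Λ : Type w} [Ring Γ] [Ring Λ] (ν : Γ →+* Λ) : Prop :=
  letI : Module Γᵐᵒᵖ Λ := Module.compHom Λ ν.op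
  Module.Projective Γᵐᵒᵖ Λ

/-- The left `R`-module `R / rad R`, where `rad R` is the Jacobson radical. -/
noncomputable abbrev modRadical (R : Type u) [Ring R] : ModuleCat.{u} R :=
  ModuleCat.of R (R ⧸ Ring.jacobson R)

/-! Put `F = Λ ⊗_Γ -`, left adjoint to restriction `G`. As `Λ_Γ` is projective, `F` is exact; as `G`
is exact, `F` preserves projectives. Write `X = Γ/𝔯` and `Y = Λ/rad Λ`. Since `Λ𝔯 = rad Λ`, `F X ≅
Y`, so `F` induces a ring map from the Ext-algebra of `X` to that of `Y`.

Every class in `Extⁿ(F X, Y)` is `F ξ` followed by the counit, for some `ξ` in `Extⁿ(X, G Y)`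
(`exists_mapExactFunctor_comp_counit`). Now `G Y` is finitely generated and killed by `𝔯`, hence a
summand of some `Xᵐ`, so `ξ` splits into classes in `Extⁿ(X, X)` (`exists_eq_sum_mapExact`). Thus
finitely many elements of `Ext⁰(Y, Y)` generate the Ext-algebra of `Y` as a right module over that
of `X`, and right Noetherianity transfers. -/

/-- A ring which is finitely generated as a right module over a right Noetherian ring is right
Noetherian. -/
theorem IsRightNoetherianRing.of_ringHom_of_finite {R : Type v} {S : Type u} [Ring R] [Ring S]
    (φ : R →+* S) {ι : Type*} [Fintype ι] (q : ι → S)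
    (hq : ∀ x : S, ∃ r : ι → R, x = ∑ i, q i * φ (r i))
    (hR : IsRightNoetherianRing R) : IsRightNoetherianRing S := by
  let : Module Rᵐᵒᵖ Sᵐᵒᵖ := Module.compHom Sᵐᵒᵖ φ.op
  have : IsScalarTower Rᵐᵒᵖ Sᵐᵒᵖ Sᵐᵒᵖ := ⟨fun r s t => mul_assoc (φ.op r) s t⟩
  have : Module.Finite Rᵐᵒᵖ Sᵐᵒᵖ := by
    refine ⟨Submodule.fg_def.2 ⟨_, Set.finite_range fun i => MulOpposite.op (q i), ?_⟩⟩
    refine eq_top_iff.2 fun x _ => ?_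
    obtain ⟨r, hr⟩ := hq x.unop
    rw [← MulOpposite.op_unop x, hr, Finset.op_sum]
    exact Submodule.sum_mem _ fun i _ =>
      Submodule.smul_mem _ (MulOpposite.op (r i)) (Submodule.subset_span ⟨i, rfl⟩)
  exact isNoetherian_of_tower Rᵐᵒᵖ inferInstance

/-! ### Ext classes and exact left adjoints -/

namespace CategoryTheory.Adjunction

open Abelian Limits

variable {C : Type*} [Category* C] [Abelian C] [HasExt.{w} C] [EnoughProjectives C]
  {D : Type*} [Category* D] [Abelian D] [HasExt.{w} D]
  {F : C ⥤ D} {G : D ⥤ C} [F.Additive] [PreservesFiniteLimits F] [PreservesFiniteColimits F]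

/-- If an exact functor `F` has a right adjoint and preserves projective objects, every Ext class
out of `F X` comes from an Ext class out of `X`. -/
theorem exists_mapExactFunctor_comp_counit (adj : F ⊣ G) [F.PreservesProjectiveObjects]
    (N : D) (n : ℕ) (X : C) (θ : Ext.{w} (F.obj X) N n) :
    ∃ ξ : Ext.{w} X (G.obj N) n,
      (ξ.mapExactFunctor F).comp (Ext.mk₀ (adj.counit.app N)) (add_zero n) = θ := by
  induction n generalizing X with
  | zero =>
    obtain ⟨g, rfl⟩ := (Ext.mk₀_bijective _ _).2 θ
    refine ⟨Ext.mk₀ (adj.homEquiv _ _ g), ?_⟩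
    rw [Ext.mapExactFunctor_mk₀, Ext.mk₀_comp_mk₀]
    exact congrArg Ext.mk₀ ((adj.homEquiv_counit _ _ _).symm.trans (Equiv.symm_apply_apply _ _))
  | succ n ih =>
    -- Dimension shifting along `0 → K → P → X → 0` with `P` projective: `F P` is projective, so `θ`
    -- dies on it and factors through the connecting class, which is the image under `F` of that of
    -- `S`.
    let S := ShortComplex.mk _ _ (kernel.condition (Projective.π X))
    have hS : S.ShortExact :=
      { exact := ShortComplex.exact_of_f_is_kernel _ (kernelIsKernel S.g) }
    have hFS := hS.map_of_exact F
    have : Projective (S.map F).X₂ := inferInstanceAs (Projective (F.obj (Projective.over X)))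
    obtain ⟨θ', hθ'⟩ := Ext.contravariant_sequence_exact₃ hFS N θ
      (Ext.eq_zero_of_projective _) (add_comm 1 n)
    obtain ⟨ξ, hξ⟩ := ih S.X₁ θ'
    refine ⟨hS.extClass.comp ξ (add_comm 1 n), ?_⟩
    rw [Ext.mapExactFunctor_comp, Ext.mapExactFunctor_extClass, ← hθ', ← hξ]
    exact Ext.comp_assoc _ _ _ _ _ (by omega)

end CategoryTheory.Adjunction

/-! ### Ring maps between Ext-algebras and finite generation -/

namespace SelfExt

open Abelian Limits

variable {C : Type*} [Category* C] [Abelian C] [HasExt.{w} C]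
  {D : Type*} [Category* D] [Abelian D] [HasExt.{w} D]

section

variable (F : C ⥤ D) [F.Additive] [PreservesFiniteLimits F] [PreservesFiniteColimits F]
  {X : C} {Y : D} (e : F.obj X ≅ Y)

/-- The map on self-extensions induced by an exact functor `F` with `F X ≅ Y`. -/
noncomputable def mapExact (n : ℕ) : SelfExt.{w} X n →+ SelfExt.{w} Y n where
  toFun a := (Ext.mk₀ e.inv).comp
    ((Ext.mapExactFunctor F (X := X) (Y := X) a).comp (Ext.mk₀ e.hom) (add_zero n)) (zero_add n)
  map_zero' := by
    change (Ext.mk₀ e.inv).comp ((Ext.mapExactFunctor F (0 : Ext X X n)).comp _ _) _ =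
      (0 : Ext Y Y n)
    simp
  map_add' a b := by
    have h (a b : Ext X X n) : (Ext.mk₀ e.inv).comp (((a + b).mapExactFunctor F).comp
        (Ext.mk₀ e.hom) (add_zero n)) (zero_add n) =
        (Ext.mk₀ e.inv).comp ((a.mapExactFunctor F).comp (Ext.mk₀ e.hom) (add_zero n))
          (zero_add n) +
        (Ext.mk₀ e.inv).comp ((b.mapExactFunctor F).comp (Ext.mk₀ e.hom) (add_zero n))
          (zero_add n) := by simp
    exact h a b

theorem mapExact_unit : mapExact F e 0 (unit X) = unit Y := by
  change (Ext.mk₀ e.inv).comp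
    ((Ext.mapExactFunctor F (Ext.mk₀ (𝟙 X))).comp (Ext.mk₀ e.hom) (add_zero 0))
      (zero_add 0) = Ext.mk₀ (𝟙 Y)
  simp [Ext.mapExactFunctor_mk₀]

/-- Between the two conjugated factors, `e.hom` and `e.inv` cancel. -/
theorem mapExact_yonedaMul {m n : ℕ} (a : SelfExt.{w} X m) (b : SelfExt.{w} X n) :
    mapExact F e _ (yonedaMul a b) = yonedaMul (mapExact F e m a) (mapExact F e n b) := by
  have h (b : Ext X X n) (a : Ext X X m) :
      (Ext.mk₀ e.inv).comp (((b.comp a (Nat.add_comm n m)).mapExactFunctor F).comp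
        (Ext.mk₀ e.hom) (add_zero _)) (zero_add _) =
      ((Ext.mk₀ e.inv).comp ((b.mapExactFunctor F).comp (Ext.mk₀ e.hom) (add_zero n))
        (zero_add n)).comp
      ((Ext.mk₀ e.inv).comp ((a.mapExactFunctor F).comp (Ext.mk₀ e.hom) (add_zero m))
        (zero_add m)) (Nat.add_comm n m) := by
    rw [Ext.mapExactFunctor_comp]
    rw [← Ext.comp_assoc_of_third_deg_zero (Ext.mk₀ e.inv) (b.mapExactFunctor F),
      Ext.comp_assoc_of_second_deg_zero, Ext.mk₀_comp_mk₀_assoc, Iso.hom_inv_id,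
      Ext.mk₀_id_comp, Ext.comp_assoc_of_third_deg_zero,
      ← Ext.comp_assoc (Ext.mk₀ e.inv) _ _ (zero_add n) (Nat.add_comm n m) (by omega)]
  exact h b a

/-- The ring homomorphism of Ext-algebras induced by an exact functor `F` with `F X ≅ Y`. -/
noncomputable def extAlgebraMap : ExtAlgebra.{w} X →+* ExtAlgebra.{w} Y :=
  DirectSum.toSemiring (fun n => (DirectSum.of (SelfExt.{w} Y) n).comp (mapExact F e n))
    (congrArg (DirectSum.of (SelfExt.{w} Y) 0) (mapExact_unit F e))
    (fun a b => (congrArg (DirectSum.of (SelfExt.{w} Y) _) (mapExact_yonedaMul F e a b)).trans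
      (DirectSum.of_mul_of _ _).symm)

theorem extAlgebraMap_of (n : ℕ) (a : SelfExt.{w} X n) :
    extAlgebraMap F e (DirectSum.of _ n a) = DirectSum.of _ n (mapExact F e n a) :=
  DirectSum.toSemiring_of _ _ _ _ _

end

theorem of_zero_mul_of {Y : D} {n : ℕ} (q : SelfExt.{w} Y 0) (a : SelfExt.{w} Y n) :
    DirectSum.of (SelfExt.{w} Y) 0 q * DirectSum.of (SelfExt.{w} Y) n a =
      DirectSum.of (SelfExt.{w} Y) n (Ext.comp (X := Y) (Y := Y) (Z := Y) a q (add_zero n)) := by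
  rw [DirectSum.of_mul_of]
  refine DirectSum.of_eq_of_gradedMonoid_eq (mk_eq_mk (zero_add n) _ _ fun h => ?_)
  exact cast_comp (X := Y) h a q (Nat.add_comm n 0)

section

variable [EnoughProjectives C] {F : C ⥤ D} {G : D ⥤ C}
  [F.Additive] [PreservesFiniteLimits F] [PreservesFiniteColimits F]
  [F.PreservesProjectiveObjects] {X : C} {Y : D} {ι : Type*} [Fintype ι]

/-- The degree-zero factors are independent of `θ` and of `n`; this is what yields finitely many
generators for all degrees at once. The witness `a i` is the adjoint class `ξ` followed by `s i`;
the `p i` pass through `F` into the generators. -/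
theorem exists_eq_sum_mapExact (adj : F ⊣ G) (e : F.obj X ≅ Y)
    (s : ι → (G.obj Y ⟶ X)) (p : ι → (X ⟶ G.obj Y))
    (hsp : ∑ i, s i ≫ p i = 𝟙 (G.obj Y)) {n : ℕ} (θ : Ext.{w} Y Y n) :
    ∃ a : ι → Ext.{w} X X n, θ = ∑ i, ((Ext.mk₀ e.inv).comp (((a i).mapExactFunctor F).comp
      (Ext.mk₀ e.hom) (add_zero n)) (zero_add n)).comp
      (Ext.mk₀ (e.inv ≫ F.map (p i) ≫ adj.counit.app Y)) (add_zero n) := by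
  obtain ⟨ξ, hξ⟩ := adj.exists_mapExactFunctor_comp_counit Y n X
    ((Ext.mk₀ e.hom).comp θ (zero_add n))
  refine ⟨fun i => ξ.comp (Ext.mk₀ (s i)) (add_zero n), ?_⟩
  have h1 : ξ = ∑ i, (ξ.comp (Ext.mk₀ (s i)) (add_zero n)).comp (Ext.mk₀ (p i))
      (add_zero n) := by
    simp only [Ext.comp_assoc_of_third_deg_zero, Ext.mk₀_comp_mk₀]
    rw [← Ext.comp_sum, ← Ext.mk₀_sum, hsp, Ext.comp_mk₀_id]
  have h2 : θ = (Ext.mk₀ e.inv).comp ((ξ.mapExactFunctor F).comp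
      (Ext.mk₀ (adj.counit.app Y)) (add_zero n)) (zero_add n) := by
    rw [hξ]; simp
  refine h2.trans ?_
  conv_lhs => rw [h1, ← Functor.mapExtAddHom_apply, map_sum, Ext.sum_comp, Ext.comp_sum]
  refine Finset.sum_congr rfl fun i _ => ?_
  simp [Ext.mapExactFunctor_comp, Ext.mapExactFunctor_mk₀]

/-- Let `F ⊣ G` with `F` exact and preserving projectives, and let `Y ≅ F X` be such that `G Y` is
a direct summand of a finite power of `X`. If the Ext-algebra of `X` is right Noetherian, so is the
Ext-algebra of `Y`. -/
theorem isRightNoetherianRing_of_adjunction (adj : F ⊣ G) (e : F.obj X ≅ Y)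
    (s : ι → (G.obj Y ⟶ X)) (p : ι → (X ⟶ G.obj Y))
    (hsp : ∑ i, s i ≫ p i = 𝟙 (G.obj Y))
    (hX : IsRightNoetherianRing (ExtAlgebra.{w} X)) :
    IsRightNoetherianRing (ExtAlgebra.{w} Y) := by
  let q : ι → SelfExt.{w} Y 0 := fun i => Ext.mk₀ (e.inv ≫ F.map (p i) ≫ adj.counit.app Y)
  refine IsRightNoetherianRing.of_ringHom_of_finite (extAlgebraMap F e)
    (fun i => DirectSum.of (SelfExt.{w} Y) 0 (q i)) ?_ hX
  intro x
  induction x using DirectSum.induction_on with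
  | zero => exact ⟨0, by simp⟩
  | add x y hx hy =>
    obtain ⟨r, rfl⟩ := hx
    obtain ⟨t, rfl⟩ := hy
    exact ⟨r + t, by simp [mul_add, Finset.sum_add_distrib]⟩
  | of n θ =>
    obtain ⟨a, ha⟩ := exists_eq_sum_mapExact adj e s p hsp θ
    refine ⟨fun i => DirectSum.of (SelfExt.{w} X) n (a i), ?_⟩
    refine (congrArg (DirectSum.of (SelfExt.{w} Y) n) ha).trans
      ((map_sum (DirectSum.of (SelfExt.{w} Y) n) _ _).trans
        (Finset.sum_congr rfl fun i _ => ?_))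
    exact ((congrArg (_ * ·) (extAlgebraMap_of F e n (a i))).trans (of_zero_mul_of _ _)).symm

end

end SelfExt

/-! ### Induction along `ν` by means of a dual basis -/

/-- A dual basis of the right `Γ`-module `Λ_Γ` given by a ring homomorphism `ν : Γ → Λ`. -/
structure RightDualBasis {Γ Λ : Type*} [Ring Γ] [Ring Λ] (ν : Γ →+* Λ) (n : ℕ) where
  /-- The elements of the dual basis. -/
  vec : Fin n → Λ
  /-- The coordinate functions of the dual basis. -/
  coord : Fin n → Λ →+ Γ
  coord_mul : ∀ i a c, coord i (a * ν c) = coord i a * c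
  sum_vec_mul : ∀ a, ∑ i, vec i * ν (coord i a) = a

theorem IsRightProjectiveOver.exists_rightDualBasis {Γ Λ : Type*} [Ring Γ] [Ring Λ]
    {ν : Γ →+* Λ} (h : IsRightProjectiveOver ν)
    (hfin : letI : Module Γᵐᵒᵖ Λ := Module.compHom Λ ν.op; Module.Finite Γᵐᵒᵖ Λ) :
    ∃ n, Nonempty (RightDualBasis ν n) := by
  let : Module Γᵐᵒᵖ Λ := Module.compHom Λ ν.op
  have : Module.Projective Γᵐᵒᵖ Λ := h
  have : Module.Finite Γᵐᵒᵖ Λ := hfin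
  obtain ⟨n, f, g, -, -, hfg⟩ := Module.Finite.exists_comp_eq_id_of_projective Γᵐᵒᵖ Λ
  refine ⟨n, ⟨{
    -- With `Λ_Γ` a retract of a free module of rank `n`, the elements are the images of the
    -- standard basis and the coordinates are the components of the section.
    vec := fun i => f fun j => if i = j then 1 else 0
    coord := fun i => MulOpposite.opAddEquiv.symm.toAddMonoidHom.comp
      ((Pi.evalAddMonoidHom _ i).comp g.toAddMonoidHom)
    coord_mul := fun i a c => ?_
    sum_vec_mul := fun a => ?_ }⟩⟩
  · have := congrFun (g.map_smul (MulOpposite.op c) a) i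
    exact congrArg MulOpposite.unop this
  · have h1 : f (g a) = a := LinearMap.congr_fun hfg a
    conv_rhs => rw [← h1, f.pi_apply_eq_sum_univ]
    rfl

namespace RightDualBasis

variable {Γ Λ : Type u} [Ring Γ] [Ring Λ] {ν : Γ →+* Λ} {n : ℕ} (b : RightDualBasis ν n)

/-- Expand `c` in the dual basis. Taking `c = a' * b.vec l` shows that `a ↦ (b.coord i (a * b.vec
j))` is multiplicative on matrices; the matrix of `1` is the idempotent defining `inducedSubgroup`.
-/
theorem coord_mul_eq_sum (i : Fin n) (a c : Λ) :
    b.coord i (a * c) = ∑ j, b.coord i (a * b.vec j) * b.coord j c := by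
  conv_lhs => rw [← b.sum_vec_mul c, Finset.mul_sum, map_sum]
  exact Finset.sum_congr rfl fun j _ => by rw [← mul_assoc, b.coord_mul]

section Module

variable (M : Type*) [AddCommGroup M] [Module Γ M]

/-- The `Λ`-module `Λ ⊗_Γ M`, realised by means of a dual basis of `Λ_Γ` as the group of tuples
fixed by an idempotent matrix. -/
def inducedSubgroup : AddSubgroup (Fin n → M) where
  carrier := {m | ∀ i, ∑ j, b.coord i (b.vec j) • m j = m i}
  zero_mem' i := by simp
  add_mem' {x y} hx hy i := by simp [Finset.sum_add_distrib, hx i, hy i]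
  neg_mem' {x} hx i := by simp [hx i]

/-- The `Λ`-module `Λ ⊗_Γ M`, as a type. -/
abbrev Induced : Type _ := b.inducedSubgroup M

variable {M}

theorem sum_coord_vec (m : b.Induced M) (i : Fin n) :
    ∑ j, b.coord i (b.vec j) • m.1 j = m.1 i := m.2 i

theorem sum_coord_smul_mem (a : Λ) (m : Fin n → M) :
    (fun i => ∑ j, b.coord i (a * b.vec j) • m j) ∈ b.inducedSubgroup M := by
  intro i
  simp_rw [Finset.smul_sum, smul_smul]
  rw [Finset.sum_comm]
  refine Finset.sum_congr rfl fun l _ => ?_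
  rw [← Finset.sum_smul]
  have := b.coord_mul_eq_sum i 1 (a * b.vec l)
  simp only [one_mul] at this
  rw [← this]

instance : SMul Λ (b.Induced M) :=
  ⟨fun a m => ⟨fun i => ∑ j, b.coord i (a * b.vec j) • m.1 j, b.sum_coord_smul_mem a m.1⟩⟩

theorem smul_apply (a : Λ) (m : b.Induced M) (i : Fin n) :
    (a • m).1 i = ∑ j, b.coord i (a * b.vec j) • m.1 j := rfl

instance : Module Λ (b.Induced M) where
  one_smul m := by ext i; simp [smul_apply, sum_coord_vec]
  mul_smul a c m := by
    ext i
    simp_rw [smul_apply, Finset.smul_sum, smul_smul]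
    rw [Finset.sum_comm]
    refine Finset.sum_congr rfl fun l _ => ?_
    rw [← Finset.sum_smul, mul_assoc, b.coord_mul_eq_sum i a]
  smul_zero a := by ext i; simp [smul_apply]
  smul_add a x y := by ext i; simp [smul_apply, Finset.sum_add_distrib]
  add_smul a c x := by ext i; simp [smul_apply, add_mul, add_smul, Finset.sum_add_distrib]
  zero_smul x := by ext i; simp [smul_apply]

/-- The unit `M → Λ ⊗_Γ M`, `m ↦ 1 ⊗ m`. -/
def toInduced : M →ₛₗ[ν] b.Induced M where
  toFun m := ⟨fun i => b.coord i 1 • m, fun i => by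
    simp_rw [smul_smul]
    rw [← Finset.sum_smul]
    have := b.coord_mul_eq_sum i 1 1
    simp only [one_mul] at this
    rw [← this]⟩
  map_add' x y := by ext i; simp
  map_smul' c x := by
    ext i
    simp_rw [smul_apply, smul_smul]
    rw [← Finset.sum_smul, ← b.coord_mul_eq_sum, mul_one, ← b.coord_mul, one_mul]

theorem toInduced_apply (m : M) (i : Fin n) : (b.toInduced m).1 i = b.coord i 1 • m := rfl

/-- The tuple of `a ⊗ x` is `(b.coord i a • x)`, so `m` stands for the tensor `∑ vec i ⊗ m i`. Hence
the image of the unit generates over `Λ`. -/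
theorem sum_vec_smul_toInduced (m : b.Induced M) :
    ∑ i, b.vec i • b.toInduced (m.1 i) = m := by
  ext j
  rw [AddSubgroup.val_finsetSum, Finset.sum_apply, ← b.sum_coord_vec m j]
  refine Finset.sum_congr rfl fun i _ => ?_
  simp_rw [smul_apply, toInduced_apply, smul_smul]
  rw [← Finset.sum_smul, ← b.coord_mul_eq_sum, mul_one]

theorem induced_hom_ext {N : Type*} [AddCommGroup N] [Module Λ N] {f g : b.Induced M →ₗ[Λ] N}
    (h : ∀ m, f (b.toInduced m) = g (b.toInduced m)) : f = g := by
  ext m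
  rw [← b.sum_vec_smul_toInduced m]
  simp [h]

/-- The map `Λ ⊗_Γ M → N`, `a ⊗ m ↦ a • h m`. -/
def inducedLift {N : Type*} [AddCommGroup N] [Module Λ N] (h : M →ₛₗ[ν] N) :
    b.Induced M →ₗ[Λ] N where
  toFun m := ∑ i, b.vec i • h (m.1 i)
  map_add' x y := by simp [Finset.sum_add_distrib]
  map_smul' a m := by
    simp_rw [smul_apply, map_sum, LinearMap.map_smulₛₗ, Finset.smul_sum, smul_smul]
    rw [Finset.sum_comm, RingHom.id_apply]
    refine Finset.sum_congr rfl fun j _ => ?_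
    rw [← Finset.sum_smul, b.sum_vec_mul]

theorem inducedLift_toInduced {N : Type*} [AddCommGroup N] [Module Λ N] (h : M →ₛₗ[ν] N) (m : M) :
    b.inducedLift h (b.toInduced m) = h m := by
  change ∑ i, b.vec i • h (b.coord i 1 • m) = h m
  simp_rw [LinearMap.map_smulₛₗ, smul_smul]
  rw [← Finset.sum_smul, b.sum_vec_mul, one_smul]

/-- Functoriality of `Λ ⊗_Γ M` in `M`. -/
def inducedMap {M' : Type*} [AddCommGroup M'] [Module Γ M'] (g : M →ₗ[Γ] M') :
    b.Induced M →ₗ[Λ] b.Induced M' where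
  toFun m := ⟨fun i => g (m.1 i), fun i => by
    simpa using congrArg g (b.sum_coord_vec m i)⟩
  map_add' x y := by ext i; simp
  map_smul' a m := by ext i; simp [smul_apply]

theorem inducedMap_apply {M' : Type*} [AddCommGroup M'] [Module Γ M'] (g : M →ₗ[Γ] M')
    (m : b.Induced M) (i : Fin n) : (b.inducedMap g m).1 i = g (m.1 i) := rfl

theorem inducedMap_toInduced {M' : Type*} [AddCommGroup M'] [Module Γ M'] (g : M →ₗ[Γ] M')
    (m : M) : b.inducedMap g (b.toInduced m) = b.toInduced (g m) := by
  ext i; simp [inducedMap_apply, toInduced_apply]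

end Module

/-- The functor `Λ ⊗_Γ -` from left `Γ`-modules to left `Λ`-modules. -/
def inducedFunctor : ModuleCat.{u} Γ ⥤ ModuleCat.{u} Λ where
  obj M := ModuleCat.of Λ (b.Induced M)
  map f := ModuleCat.ofHom (b.inducedMap f.hom)

instance : b.inducedFunctor.Additive where

/-- `Λ ⊗_Γ -` is left adjoint to restriction of scalars. -/
noncomputable def adjunction : b.inducedFunctor ⊣ ModuleCat.restrictScalars.{u} ν :=
  Adjunction.mkOfHomEquiv
    { homEquiv M N :=
        { toFun g := ModuleCat.semilinearMapAddEquiv ν M N (g.hom.comp b.toInduced)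
          invFun h := ModuleCat.ofHom (b.inducedLift ((ModuleCat.semilinearMapAddEquiv ν M N).symm h))
          left_inv g := by
            ext : 1
            refine b.induced_hom_ext fun m => ?_
            exact b.inducedLift_toInduced _ m
          right_inv h := by
            ext m
            exact b.inducedLift_toInduced _ m }
      homEquiv_naturality_left_symm := by
        intro M M' N f g
        ext : 1
        refine b.induced_hom_ext fun m => ?_
        let g' := (ModuleCat.semilinearMapAddEquiv ν M' N).symm g
        let fg := (ModuleCat.semilinearMapAddEquiv ν M N).symm (f ≫ g)
        change b.inducedLift fg (b.toInduced m) =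
          b.inducedLift g' (b.inducedMap f.hom (b.toInduced m))
        rw [b.inducedMap_toInduced, b.inducedLift_toInduced, b.inducedLift_toInduced]
        rfl
      homEquiv_naturality_right := by
        intro M N N' f g
        rfl }

instance : Limits.PreservesFiniteColimits b.inducedFunctor :=
  have := b.adjunction.leftAdjoint_preservesColimits
  inferInstance

instance : Limits.PreservesFiniteLimits b.inducedFunctor := by
  rw [Functor.preservesFiniteLimits_iff_forall_exact_map_and_mono]
  intro S hS
  have hf := (ModuleCat.mono_iff_injective _).1 hS.mono_f
  refine ⟨?_, ?_⟩
  · rw [ShortComplex.moduleCat_exact_iff]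
    intro m hm
    have hm' : ∀ i, ∃ y : S.X₁, S.f.hom y = m.1 i := fun i =>
      (ShortComplex.moduleCat_exact_iff S).1 hS.exact _ (congrFun (congrArg Subtype.val hm) i)
    choose y hy using hm'
    -- The componentwise lift `y` is fixed by the idempotent because its image `m` is and `S.f` is
    -- injective.
    refine ⟨⟨y, fun i => hf ?_⟩, Subtype.ext (funext hy)⟩
    change S.f.hom _ = S.f.hom _
    rw [map_sum, hy, ← b.sum_coord_vec m i]
    simp [hy]
  · rw [ModuleCat.mono_iff_injective]
    intro m m' h
    exact Subtype.ext (funext fun i => hf (congrFun (congrArg Subtype.val h) i))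

instance {R S : Type u} [Ring R] [Ring S] (f : R →+* S) :
    (ModuleCat.restrictScalars.{u} f).PreservesEpimorphisms where
  preserves g hg := by
    rw [ModuleCat.epi_iff_surjective] at hg ⊢
    exact hg

instance : b.inducedFunctor.PreservesProjectiveObjects :=
  Functor.preservesProjectiveObjects_of_adjunction_of_preservesEpimorphisms b.adjunction

end RightDualBasis

/-! ### Modules killed by the radical, and induction of `Γ / rad Γ` -/

/-- Over the semisimple ring `R ⧸ I` the finite module `M` is projective, hence a summand of a
finite free module. -/
theorem Module.IsTorsionBySet.exists_sum_comp_eq_id {R M : Type*} [Ring R] [AddCommGroup M]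
    [Module R M] {I : Ideal R} [I.IsTwoSided] [IsSemisimpleRing (R ⧸ I)] [Module.Finite R M]
    (h : Module.IsTorsionBySet R M (I : Set R)) :
    ∃ (n : ℕ) (s : Fin n → M →ₗ[R] R ⧸ I) (p : Fin n → (R ⧸ I) →ₗ[R] M),
      ∑ i, p i ∘ₗ s i = LinearMap.id := by
  let : Module (R ⧸ I) M := h.module
  have : IsScalarTower R (R ⧸ I) M := h.isScalarTower
  have : Module.Finite (R ⧸ I) M := Module.Finite.of_restrictScalars_finite R (R ⧸ I) M
  have : Module.Projective (R ⧸ I) M := Module.projective_of_isSemisimpleRing _ M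
  obtain ⟨n, f, g, -, -, hfg⟩ := Module.Finite.exists_comp_eq_id_of_projective (R ⧸ I) M
  refine ⟨n, fun i => ((LinearMap.proj i).comp g).restrictScalars R,
    fun i => (f.comp (LinearMap.single (R ⧸ I) (fun _ => R ⧸ I) i)).restrictScalars R, ?_⟩
  ext m
  have h1 : f (g m) = m := LinearMap.congr_fun hfg m
  simp only [LinearMap.sum_apply, LinearMap.comp_apply, LinearMap.restrictScalars_apply,
    LinearMap.id_apply, LinearMap.proj_apply]
  rw [← map_sum]
  refine (congrArg f ?_).trans h1
  exact Finset.univ_sum_single (g m)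

theorem ModuleCat.exists_sum_comp_eq_id {Γ : Type u} [Ring Γ] [IsArtinianRing Γ]
    (Y : ModuleCat.{u} Γ) [Module.Finite Γ Y]
    (hY : Module.IsTorsionBySet Γ Y (Ring.jacobson Γ : Set Γ)) :
    ∃ (n : ℕ) (s : Fin n → (Y ⟶ modRadical Γ)) (p : Fin n → (modRadical Γ ⟶ Y)),
      ∑ i, s i ≫ p i = 𝟙 Y := by
  obtain ⟨n, s, p, hsp⟩ := hY.exists_sum_comp_eq_id
  refine ⟨n, fun i => ModuleCat.ofHom (s i), fun i => ModuleCat.ofHom (p i), ?_⟩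
  ext y
  simpa [ModuleCat.hom_sum] using LinearMap.congr_fun hsp y

namespace RightDualBasis

variable {Γ Λ : Type u} [Ring Γ] [Ring Λ] {ν : Γ →+* Λ} {n : ℕ} (b : RightDualBasis ν n)

/-- `Λ ⊗_Γ (Γ / I) ≃ Λ / Λ I`. -/
noncomputable def inducedQuotientEquiv (I : Ideal Γ) (J : Ideal Λ) (h : Ideal.map ν I = J) :
    b.Induced (Γ ⧸ I) ≃ₗ[Λ] Λ ⧸ J :=
  let φ : (Γ ⧸ I) →ₛₗ[ν] Λ ⧸ J := Submodule.mapQ I J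
    { toFun := ν, map_add' := map_add ν, map_smul' := map_mul ν }
    (fun c hc => h ▸ Ideal.mem_map_of_mem ν hc)
  let ψ : (Λ ⧸ J) →ₗ[Λ] b.Induced (Γ ⧸ I) := Submodule.liftQ J
    (LinearMap.toSpanSingleton Λ _ (b.toInduced (Submodule.Quotient.mk (1 : Γ)))) (by
      rw [← h]
      refine Ideal.map_le_iff_le_comap.2 fun c hc => ?_
      change ν c • b.toInduced (Submodule.Quotient.mk (1 : Γ)) = 0
      rw [← LinearMap.map_smulₛₗ, ← Submodule.Quotient.mk_smul, smul_eq_mul, mul_one,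
        (Submodule.Quotient.mk_eq_zero I).2 hc, map_zero])
  LinearEquiv.ofLinearMap (b.inducedLift φ) ψ
    (by
      ext
      change b.inducedLift φ ((1 : Λ) • b.toInduced (Submodule.Quotient.mk (1 : Γ))) = _
      rw [one_smul, b.inducedLift_toInduced]
      change Submodule.Quotient.mk (ν 1) = _
      rw [map_one]
      rfl)
    (by
      refine b.induced_hom_ext fun m => ?_
      obtain ⟨c, rfl⟩ := Submodule.Quotient.mk_surjective I m
      change ψ (b.inducedLift φ _) = b.toInduced _
      rw [b.inducedLift_toInduced]
      change ν c • b.toInduced (Submodule.Quotient.mk (1 : Γ)) = _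
      rw [← LinearMap.map_smulₛₗ, ← Submodule.Quotient.mk_smul, smul_eq_mul, mul_one])

end RightDualBasis

/-- `Ideal.map ν (Ring.jacobson Γ)` is the left ideal `Λ · rad Γ` of `Λ`. -/
theorem mainTheorem8 {k : Type v} [Field k] {Γ Λ : Type u} [Ring Γ] [Ring Λ]
    [Algebra k Γ] [Algebra k Λ] [FiniteDimensional k Γ] [FiniteDimensional k Λ]
    (ν : Γ →ₐ[k] Λ) (hν : Function.Injective ν)
    (hrad : Ideal.map ν (Ring.jacobson Γ) = Ring.jacobson Λ)
    (hproj : IsRightProjectiveOver (ν : Γ →+* Λ))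
    (hΓ : IsRightNoetherianRing (ExtAlgebra (modRadical Γ))) :
    IsRightNoetherianRing (ExtAlgebra (modRadical Λ)) := by
  have hfin : letI : Module Γᵐᵒᵖ Λ := Module.compHom Λ (ν : Γ →+* Λ).op
      Module.Finite Γᵐᵒᵖ Λ := by
    let : Module Γᵐᵒᵖ Λ := Module.compHom Λ (ν : Γ →+* Λ).op
    have : IsScalarTower k Γᵐᵒᵖ Λ := ⟨fun c x y => by
      change y * ν (c • x.unop) = c • (y * ν x.unop)
      rw [map_smul, mul_smul_comm]⟩
    exact Module.Finite.of_restrictScalars_finite k Γᵐᵒᵖ Λ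
  obtain ⟨n, ⟨b⟩⟩ := hproj.exists_rightDualBasis hfin
  have : IsArtinianRing Γ := IsArtinianRing.of_finite k Γ
  let Y := (ModuleCat.restrictScalars (ν : Γ →+* Λ)).obj (modRadical Λ)
  have hY : Module.IsTorsionBySet Γ Y (Ring.jacobson Γ : Set Γ) := by
    intro y c
    obtain ⟨a, rfl⟩ := Submodule.Quotient.mk_surjective (Ring.jacobson Λ) y
    refine (Submodule.Quotient.mk_eq_zero (Ring.jacobson Λ)).2 ?_
    -- `ν c` lies in `Λ𝔯 = rad Λ`, which is two-sided, so `ν c * a` stays in it.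
    exact Ideal.mul_mem_right a _ (hrad ▸ Ideal.mem_map_of_mem ν c.2)
  have hYfin : Module.Finite Γ Y := by
    let : Module k Y := inferInstanceAs (Module k (Λ ⧸ Ring.jacobson Λ))
    have : Module.Finite k Y := inferInstanceAs (Module.Finite k (Λ ⧸ Ring.jacobson Λ))
    have : IsScalarTower k Γ Y := ⟨fun c x y => by
      change ν (c • x) • (y : Λ ⧸ Ring.jacobson Λ) = c • (ν x • (y : Λ ⧸ Ring.jacobson Λ))
      rw [map_smul]
      exact smul_assoc (M := k) (N := Λ) (α := Λ ⧸ Ring.jacobson Λ) c (ν x) y⟩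
    exact Module.Finite.of_restrictScalars_finite k Γ Y
  obtain ⟨m, s, p, hsp⟩ := Y.exists_sum_comp_eq_id hY
  let e : b.inducedFunctor.obj (modRadical Γ) ≅ modRadical Λ :=
    (b.inducedQuotientEquiv _ _ hrad).toModuleIso
  exact SelfExt.isRightNoetherianRing_of_adjunction b.adjunction e s p hsp hΓ
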